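/- For two metric spaces $X$ and $Y$, a subset $S\subseteq X$ is a copy of $Y$ if there is a distance-preserving bijection $Y\to S$, and $\chi(X;Y)$ denotes the minimal $k$ such that the points of $X$ can be coloured with $k$ colours without a monochromatic copy of $Y$. Let $\mathbb{R}^n_\infty$ be $\mathbb{R}^n$ with the metric $\|x-y\|_\infty=\max_i|x_i-y_i|$. For a finite metric space $\mathcal{M}=(M,\rho)$ with at least two points, let $d(\mathcal{M})$ be its diameter, and let $l(\mathcal{M})>0$ be the smallest number $l$ such that for every two points $x,y\in M$ there are $z_0,z_1,\dots,z_t\in M$ with $z_0=x$, $z_t=y$ and $\rho(z_i,z_{i+1})\le l$ for all $0\le i\le t-1$. Theorem. For every finite metric space $\mathcal{M}$ with at least two points there is a function $\varepsilon:\mathbb{N}\to\mathbb{R}$ with $\varepsilon(n)\to 0$ as $n\to\infty$ such that for all $n\ge 2$ the number $\chi(\mathbb{R}^n_\infty;\mathcal{M})$ is finite and $$\chi(\mathbb{R}^n_\infty;\mathcal{M})<(1+\varepsilon(n))\,n\log n\left(1+\frac{l(\mathcal{M})}{d(\mathcal{M})}\right)^n,$$ where $\log$ is the natural logarithm. -/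

import Mathlib

open Filter Topology

/-- A subset `S` of the metric space `X` is a copy of the metric space `Y` if there is a
distance-preserving bijection from `Y` onto `S`. -/
def IsCopy {X : Type*} [MetricSpace X] (Y : Type*) [MetricSpace Y] (S : Set X) : Prop :=
  Nonempty (Y ≃ᵢ S)

/-- The coloring `c` of the points of `X` has no monochromatic copy of `Y`. -/
def NoMonochromaticCopy {X : Type*} [MetricSpace X] (Y : Type*) [MetricSpace Y] {K : Type*}
    (c : X → K) : Prop :=
  ¬ ∃ S : Set X, IsCopy Y S ∧ ∃ a : K, ∀ x ∈ S, c x = a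

/-- The chromatic number of the space `X` with the forbidden subspace `Y`: the minimal `k` such
that there is a coloring of the points of `X` with `k` colors and no monochromatic copy of `Y`
(it is `⊤` if no finite number of colors suffices). -/
noncomputable def forbiddenChromaticNumber (X : Type*) [MetricSpace X]
    (Y : Type*) [MetricSpace Y] : ℕ∞ :=
  ⨅ k ∈ {k : ℕ | ∃ c : X → Fin k, NoMonochromaticCopy Y c}, (k : ℕ∞)

/-- Every two points of `M` are connected by a finite chain of points of `M` whose consecutive
members are at distance at most `l`. -/
def ChainConnected (M : Type*) [MetricSpace M] (l : ℝ) : Prop :=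
  ∀ x y : M, ∃ (t : ℕ) (z : ℕ → M), z 0 = x ∧ z t = y ∧ ∀ i < t, dist (z i) (z (i + 1)) ≤ l

/-- The smallest step length `l > 0` for which every two points of `M` are connected by a chain. -/
noncomputable def stepLength (M : Type*) [MetricSpace M] : ℝ :=
  sInf {l : ℝ | 0 < l ∧ ChainConnected M l}

/-- For a finite space with at least two points the infimum that defines `stepLength` is a
minimum. -/
theorem stepLength_isLeast (M : Type*) [MetricSpace M] [Finite M] [Nontrivial M] :
    IsLeast {l : ℝ | 0 < l ∧ ChainConnected M l} (stepLength M) := by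
  set A : Set ℝ := {l : ℝ | 0 < l ∧ ChainConnected M l} with hA
  set D : Set ℝ := Set.range (fun p : M × M => dist p.1 p.2) with hD
  have hfin : (A ∩ D).Finite := (Set.finite_range _).subset Set.inter_subset_right
  have key : ∀ l ∈ A, ∃ m ∈ A ∩ D, m ≤ l := by
    rintro l ⟨-, hl⟩
    have hne : (D ∩ Set.Iic l).Nonempty := by
      obtain ⟨x, y, hxy⟩ := exists_pair_ne M
      obtain ⟨t, z, h0, ht, hz⟩ := hl x y
      rcases Nat.eq_zero_or_pos t with rfl | hpos
      · exact absurd (h0.symm.trans ht) hxy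
      · exact ⟨_, ⟨(z 0, z 1), rfl⟩, hz 0 hpos⟩
    have hf : (D ∩ Set.Iic l).Finite := (Set.finite_range _).subset Set.inter_subset_left
    obtain ⟨m, ⟨hmD, hml⟩, hmax⟩ := hf.exists_maximal hne
    have hmax' : ∀ u ∈ D, u ≤ l → u ≤ m := fun u hu hul =>
      (le_total u m).elim id fun h => hmax ⟨hu, hul⟩ h
    have hch : ChainConnected M m := by
      intro x y
      obtain ⟨t, z, h0, ht, hz⟩ := hl x y
      exact ⟨t, z, h0, ht, fun i hi => hmax' _ ⟨(z i, z (i + 1)), rfl⟩ (hz i hi)⟩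
    refine ⟨m, ⟨⟨?_, hch⟩, hmD⟩, hml⟩
    by_contra hm0
    obtain ⟨x, y, hxy⟩ := exists_pair_ne M
    obtain ⟨t, z, h0, ht, hz⟩ := hch x y
    have hc : ∀ i ≤ t, z i = x := by
      intro i
      induction i with
      | zero => exact fun _ => h0
      | succ j ih =>
        intro hj
        have h1 : dist (z j) (z (j + 1)) ≤ 0 := (hz j (by omega)).trans (not_lt.mp hm0)
        rw [← dist_le_zero.mp h1]
        exact ih (by omega)
    exact hxy ((hc t le_rfl).symm.trans ht)
  have hAne : A.Nonempty := by
    obtain ⟨b, hb⟩ := (Set.finite_range (fun p : M × M => dist p.1 p.2)).bddAbove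
    refine ⟨max b 1, lt_of_lt_of_le one_pos (le_max_right _ _), fun x y => ?_⟩
    refine ⟨1, fun i => if i = 0 then x else y, by simp, by simp, fun i hi => ?_⟩
    exact (hb ⟨(_, _), rfl⟩).trans (le_max_left _ _)
  have hne : (A ∩ D).Nonempty := by
    obtain ⟨l, hl⟩ := hAne
    obtain ⟨m, hm, -⟩ := key l hl
    exact ⟨m, hm⟩
  obtain ⟨m, hm, hmin⟩ := hfin.exists_minimal hne
  have hleast : IsLeast A m := by
    refine ⟨hm.1, fun l hl => ?_⟩
    obtain ⟨u, hu, hul⟩ := key l hl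
    exact ((le_total m u).elim id fun h => hmin hu h).trans hul
  have : stepLength M = m := hleast.csInf_eq
  rw [this]
  exact hleast

/-! Half-open cubes of side at most `d`, repeated with period `d + l` in every coordinate, form a
set in which points of different cubes are more than `l` apart. A copy of `M` inside it is joined by
steps of length at most `l`, so it stays in one cube; but there all distances are less than `d`,
while `M` has two points at distance `d` (`exists_coloring_of_cover`). The colors are therefore
translates of this periodic set that cover the space, that is, translates of a cube that cover a
torus. On the grid `(ℤ/m)ⁿ`, a cube of side `a = ⌊s * m⌋₊`, `s = d / (d + l)`, has density about
`sⁿ`, and greedy covering needs about `n log m / (a / m)ⁿ` translates. The choice `m = n⌈log n⌉`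
keeps `log m ∼ log n` and makes the loss from rounding `a` tend to a factor `1`. -/

/-! ### Greedy covering of a finite group by translates. -/

/-- In a finite group, some translate of `A` meets a given set `U` in at least the average
proportion. -/
theorem exists_translate_card_ge {G : Type*} [AddCommGroup G] [Fintype G] [DecidableEq G]
    (A U : Finset G) :
    ∃ t : G, (U.card : ℝ) * (A.card / Fintype.card G) ≤ (U.filter fun u => u - t ∈ A).card := by
  have hG : (0 : ℝ) < Fintype.card G := by exact_mod_cast Fintype.card_pos
  -- Double counting: each `u` lies in exactly `|A|` translates of `A`, because `t ↦ u - t` is a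
  -- bijection.
  have hsum : ∑ t : G, (U.filter fun u => u - t ∈ A).card = U.card * A.card := by
    simp_rw [Finset.card_filter]
    rw [Finset.sum_comm, ← smul_eq_mul, ← Finset.sum_const]
    refine Finset.sum_congr rfl fun u _ => ?_
    rw [← Finset.card_filter]
    refine Finset.card_bij' (fun t _ => u - t) (fun a _ => u - a) ?_ ?_ ?_ ?_ <;> simp
  have hsum' : ∑ t : G, ((U.filter fun u => u - t ∈ A).card : ℝ) = U.card * A.card := by
    exact_mod_cast hsum
  obtain ⟨t, -, ht⟩ := Finset.exists_le_of_sum_le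
    (s := (Finset.univ : Finset G)) (f := fun _ => (U.card : ℝ) * (A.card / Fintype.card G))
    (g := fun t => ((U.filter fun u => u - t ∈ A).card : ℝ)) Finset.univ_nonempty (by
      rw [hsum', Finset.sum_const, nsmul_eq_mul, Finset.card_univ]
      apply le_of_eq
      field_simp)
  exact ⟨t, ht⟩

/-- Greedy choice of `N` translates of `A` leaves at most the expected number of points
uncovered. -/
theorem exists_translates_card_uncovered_le {G : Type*} [AddCommGroup G] [Fintype G]
    [DecidableEq G] (A : Finset G) (N : ℕ) :
    ∃ t : Fin N → G, ((Finset.univ.filter fun g => ∀ i, g - t i ∉ A).card : ℝ) ≤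
      Fintype.card G * (1 - A.card / Fintype.card G : ℝ) ^ N := by
  have hG : (0 : ℝ) < Fintype.card G := by exact_mod_cast Fintype.card_pos
  have hp : (0 : ℝ) ≤ 1 - A.card / Fintype.card G := by
    rw [sub_nonneg, div_le_one hG]
    exact_mod_cast A.card_le_univ
  induction N with
  | zero => exact ⟨Fin.elim0, by simp⟩
  | succ N ih =>
    obtain ⟨t, ht⟩ := ih
    set U := Finset.univ.filter fun g => ∀ i, g - t i ∉ A with hU
    obtain ⟨s, hs⟩ := exists_translate_card_ge A U
    refine ⟨Fin.cons s t, ?_⟩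
    have hset : (Finset.univ.filter fun g => ∀ i, g - (Fin.cons s t : Fin (N + 1) → G) i ∉ A) =
        U.filter fun u => ¬ u - s ∈ A := by
      ext g
      simp [hU, Fin.forall_fin_succ, and_comm]
    have hcard : ((U.filter fun u => u - s ∈ A).card : ℝ) +
        (U.filter fun u => ¬ u - s ∈ A).card = U.card := by
      exact_mod_cast Finset.card_filter_add_card_filter_not _
    rw [hset, pow_succ, ← mul_assoc]
    calc ((U.filter fun u => ¬ u - s ∈ A).card : ℝ)
        ≤ U.card * (1 - A.card / Fintype.card G) := by linarith
      _ ≤ _ := mul_le_mul_of_nonneg_right ht hp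

/-- A finite group is covered by any number of translates of `A` that exceeds
`log |G| / (|A| / |G|)`. -/
theorem exists_translates_cover {G : Type*} [AddCommGroup G] [Fintype G]
    [DecidableEq G] (A : Finset G) (N : ℕ)
    (hN : Real.log (Fintype.card G) < (A.card / Fintype.card G : ℝ) * N) :
    ∃ t : Fin N → G, ∀ g, ∃ i, g - t i ∈ A := by
  have hG : (0 : ℝ) < Fintype.card G := by exact_mod_cast Fintype.card_pos
  have hp : (0 : ℝ) ≤ 1 - A.card / Fintype.card G := by
    rw [sub_nonneg, div_le_one hG]
    exact_mod_cast A.card_le_univ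
  obtain ⟨t, ht⟩ := exists_translates_card_uncovered_le A N
  refine ⟨t, ?_⟩
  set p : ℝ := A.card / Fintype.card G
  have hlt : (Fintype.card G : ℝ) * (1 - p) ^ N < 1 := by
    calc (Fintype.card G : ℝ) * (1 - p) ^ N
        ≤ Real.exp (Real.log (Fintype.card G)) * Real.exp (-p) ^ N := by
          rw [Real.exp_log hG]
          gcongr
          linarith [Real.add_one_le_exp (-p)]
      _ = Real.exp (Real.log (Fintype.card G) - p * N) := by
          rw [← Real.exp_nat_mul, ← Real.exp_add]
          ring_nf
      _ < 1 := by
          rw [Real.exp_lt_one_iff]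
          linarith
  -- A natural number below `1` is zero.
  have h0 : (Finset.univ.filter fun g => ∀ i, g - t i ∉ A).card = 0 := by
    have := ht.trans_lt hlt
    exact Nat.lt_one_iff.mp (by exact_mod_cast this)
  rw [Finset.card_eq_zero, Finset.filter_eq_empty_iff] at h0
  intro g
  simpa using h0 (Finset.mem_univ g)

/-- The discrete torus `(ℤ/m)ⁿ` is covered by any number of translates of the discrete cube
`{0, …, a - 1}ⁿ` that exceeds `n log m / (a / m)ⁿ`. -/
theorem exists_cubes_cover_torus (n m a N : ℕ) [NeZero m] (ham : a ≤ m)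
    (hN : n * Real.log m < ((a : ℝ) / m) ^ n * N) :
    ∃ t : Fin N → Fin n → ZMod m, ∀ g : Fin n → ZMod m, ∃ i, ∀ j, (g j - t i j).val < a := by
  have hA : (Finset.univ.filter fun z : ZMod m => z.val < a).card = a := by
    refine (Finset.card_nbij' (t := Finset.range a) ZMod.val (fun k => (k : ZMod m))
      ?_ ?_ ?_ ?_).trans (Finset.card_range a)
    · intro z hz; simpa using hz
    · intro k hk
      have hk' : k < a := by simpa using hk
      simpa [ZMod.val_natCast_of_lt (hk'.trans_le ham)] using hk'
    · intro z _; simp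
    · intro k hk
      have hk' : k < a := by simpa using hk
      exact ZMod.val_natCast_of_lt (hk'.trans_le ham)
  obtain ⟨t, ht⟩ := exists_translates_cover
    (Fintype.piFinset fun _ : Fin n => Finset.univ.filter fun z : ZMod m => z.val < a) N (by
      simpa [Fintype.card_piFinset, hA, ZMod.card, Real.log_pow, div_pow] using hN)
  exact ⟨t, fun g => by simpa [Fintype.mem_piFinset] using ht g⟩

/-! ### From a cover to a coloring. -/

/-- Two points of cells `[c + km, c + km + a)` of the same color whose distance is at most
`m - a` lie in the same cell. -/
theorem cell_eq_of_abs_sub_le {m a : ℕ} {c k k' : ℤ} {u u' r : ℝ} (hr : r ≤ m - a)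
    (h1 : 0 ≤ ⌊u⌋ - c - k * m) (h2 : ⌊u⌋ - c - k * m < a)
    (h1' : 0 ≤ ⌊u'⌋ - c - k' * m) (h2' : ⌊u'⌋ - c - k' * m < a) (hu : |u - u'| ≤ r) :
    k = k' := by
  -- If `k < k'`, then `u < c + k * m + a` and `u' ≥ c + (k + 1) * m`, so `u' - u > m - a ≥ r`.
  -- Strictness comes from the half-open cells.
  have aux : ∀ {k k' : ℤ} {u u' : ℝ}, ⌊u⌋ - c - k * m < a → 0 ≤ ⌊u'⌋ - c - k' * m →
      |u - u'| ≤ r → ¬ k < k' := by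
    intro k k' u u' h2 h1' hu hk
    have e1 : (⌊u⌋ : ℝ) + 1 ≤ c + k * m + a := by
      have : ⌊u⌋ + 1 ≤ c + k * m + a := by linarith
      exact_mod_cast this
    have e2 : (c : ℝ) + k' * m ≤ ⌊u'⌋ := by
      have : c + k' * m ≤ ⌊u'⌋ := by linarith
      exact_mod_cast this
    have e3 : ((k : ℝ) + 1) * m ≤ k' * m := by
      have : (k : ℝ) + 1 ≤ k' := by exact_mod_cast hk
      gcongr
    have := Int.lt_floor_add_one u
    have := Int.floor_le u'
    have := (abs_le.mp hu).1
    linarith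
  rcases lt_trichotomy k k' with h | h | h
  · exact absurd h (aux h2 h1' hu)
  · exact h
  · exact absurd h (aux h2' h1 (by rwa [abs_sub_comm]))

/-- A chain of steps at most `l` inside one color class of the periodic cube coloring stays in one
cell, so the class holds no copy of a space with diameter `d` and step length at most `l`. -/
theorem exists_coloring_of_cover (M : Type*) [MetricSpace M] {n m a N : ℕ} [NeZero m]
    {l d : ℝ} (hl : 0 < l) (hd : 0 < d) (hM : ChainConnected M l)
    (hdiam : ∃ x y : M, dist x y = d) (ha : (a : ℝ) ≤ d / (d + l) * m)
    (hcov : ∃ t : Fin N → Fin n → ZMod m, ∀ g : Fin n → ZMod m, ∃ i, ∀ j, (g j - t i j).val < a) :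
    ∃ c : (Fin n → ℝ) → Fin N, NoMonochromaticCopy M c := by
  obtain ⟨t, ht⟩ := hcov
  have hm : (0 : ℝ) < m := by exact_mod_cast NeZero.pos m
  have hdl : 0 < d + l := by positivity
  -- Scaling by `q` turns the period `d + l` into `m`, so a cell side `a` is at most `q * d` and the
  -- gap `m - a` is at least `q * l`.
  set q : ℝ := m / (d + l) with hq
  have hq0 : 0 < q := by positivity
  have hqd : (a : ℝ) ≤ q * d := by
    calc (a : ℝ) ≤ d / (d + l) * m := ha
      _ = q * d := by rw [hq]; ring
  have hql : q * l ≤ m - a := by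
    have : q * (d + l) = m := by rw [hq]; field_simp
    linarith
  choose c hc using fun x : Fin n → ℝ => ht fun j => ((⌊q * x j⌋ : ℤ) : ZMod m)
  refine ⟨c, ?_⟩
  rintro ⟨S, ⟨e⟩, i, hi⟩
  have hcell : ∀ x : M, ∀ j, ∃ k : ℤ,
      0 ≤ ⌊q * (e x : Fin n → ℝ) j⌋ - ((t i j).val : ℤ) - k * m ∧
      ⌊q * (e x : Fin n → ℝ) j⌋ - ((t i j).val : ℤ) - k * m < a := by
    intro x j
    have h := hc (e x) j
    rw [hi _ (e x).2] at h
    set f := ⌊q * (e x : Fin n → ℝ) j⌋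
    have hval : (((f : ZMod m) - t i j).val : ℤ) = (f - ((t i j).val : ℤ)) % m := by
      rw [← ZMod.val_intCast]
      simp
    have hlt : (f - ((t i j).val : ℤ)) % m < a := by
      rw [← hval]; exact_mod_cast h
    have hnn : 0 ≤ (f - ((t i j).val : ℤ)) % m :=
      Int.emod_nonneg _ (by exact_mod_cast NeZero.ne m)
    have hdm := Int.emod_add_mul_ediv (f - ((t i j).val : ℤ)) m
    refine ⟨(f - ((t i j).val : ℤ)) / m, ?_, ?_⟩ <;> linarith
  choose k hk1 hk2 using hcell
  have hdist : ∀ x y : M, ∀ j,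
      |q * (e x : Fin n → ℝ) j - q * (e y : Fin n → ℝ) j| ≤ q * dist x y := by
    intro x y j
    rw [← mul_sub, abs_mul, abs_of_pos hq0]
    gcongr
    rw [← e.dist_eq x y, Subtype.dist_eq, ← Real.dist_eq]
    exact dist_le_pi_dist _ _ j
  have hstep : ∀ x y : M, dist x y ≤ l → k x = k y := by
    intro x y hxy
    funext j
    exact cell_eq_of_abs_sub_le hql (hk1 x j) (hk2 x j) (hk1 y j) (hk2 y j)
      ((hdist x y j).trans (by gcongr))
  have hconst : ∀ x y : M, k x = k y := by
    intro x y
    obtain ⟨s, z, h0, hs, hz⟩ := hM x y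
    have : ∀ r ≤ s, k (z r) = k x := by
      intro r
      induction r with
      | zero => intro _; rw [h0]
      | succ r ih => exact fun hr => (hstep _ _ (hz r hr)).symm.trans (ih (by omega))
    rw [← this s le_rfl, hs]
  obtain ⟨x, y, hxy⟩ := hdiam
  -- Both points lie in the same half-open cell, whence the strict inequality.
  have hlt : dist (e x : Fin n → ℝ) (e y) < d := by
    rw [dist_pi_lt_iff hd]
    intro j
    have hbound : ∀ w : M, k w = k x →
        ((t i j).val : ℝ) + k x j * m ≤ q * (e w : Fin n → ℝ) j ∧
        q * (e w : Fin n → ℝ) j < (t i j).val + k x j * m + a := by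
      intro w hw
      have h1 := hk1 w j
      have h2 := hk2 w j
      rw [hw] at h1 h2
      set f := ⌊q * (e w : Fin n → ℝ) j⌋ with hf
      have e1 : ((t i j).val : ℝ) + k x j * m ≤ f := by
        have : ((t i j).val : ℤ) + k x j * m ≤ f := by linarith
        exact_mod_cast this
      have e2 : (f : ℝ) + 1 ≤ (t i j).val + k x j * m + a := by
        have : f + 1 ≤ ((t i j).val : ℤ) + k x j * m + a := by linarith
        exact_mod_cast this
      exact ⟨e1.trans (Int.floor_le _), (Int.lt_floor_add_one _).trans_le e2⟩
    obtain ⟨x1, x2⟩ := hbound x rfl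
    obtain ⟨y1, y2⟩ := hbound y (hconst y x)
    have : q * dist ((e x : Fin n → ℝ) j) ((e y : Fin n → ℝ) j) < q * d := by
      rw [Real.dist_eq, ← abs_of_pos hq0, ← abs_mul, abs_of_pos hq0, mul_sub]
      refine lt_of_lt_of_le ?_ hqd
      rw [abs_lt]
      constructor <;> linarith
    exact lt_of_mul_lt_mul_left this hq0.le
  rw [← Subtype.dist_eq, e.dist_eq, hxy] at hlt
  exact lt_irrefl _ hlt

theorem forbiddenChromaticNumber_le_of_coloring {X : Type*} [MetricSpace X] {Y : Type*}
    [MetricSpace Y] {N : ℕ} (h : ∃ c : X → Fin N, NoMonochromaticCopy Y c) :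
    ∃ k : ℕ, forbiddenChromaticNumber X Y = (k : ℕ∞) ∧ k ≤ N := by
  have hle : forbiddenChromaticNumber X Y ≤ (N : ℕ∞) := iInf₂_le N h
  obtain ⟨k, hk⟩ := ENat.ne_top_iff_exists.mp (ne_top_of_le_ne_top (ENat.natCast_ne_top N) hle)
  refine ⟨k, hk.symm, ?_⟩
  rw [← hk] at hle
  exact_mod_cast hle

theorem exists_dist_eq_diam (M : Type*) [MetricSpace M] [Finite M] [Nonempty M] :
    ∃ x y : M, dist x y = Metric.diam (Set.univ : Set M) := by
  obtain ⟨⟨x, y⟩, hxy⟩ := Finite.exists_max fun p : M × M => dist p.1 p.2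
  refine ⟨x, y, le_antisymm
    (Metric.dist_le_diam_of_mem (Set.toFinite _).isBounded trivial trivial)
    (Metric.diam_le_of_forall_dist_le dist_nonneg fun u _ v _ => hxy (u, v))⟩

theorem stepLength_le_diam (M : Type*) [MetricSpace M] [Finite M] [Nontrivial M] :
    stepLength M ≤ Metric.diam (Set.univ : Set M) := by
  have hle : ∀ x y : M, dist x y ≤ Metric.diam (Set.univ : Set M) := fun x y =>
    Metric.dist_le_diam_of_mem (Set.toFinite _).isBounded trivial trivial
  obtain ⟨x, y, hxy⟩ := exists_pair_ne M
  refine (stepLength_isLeast M).2 ⟨(dist_pos.mpr hxy).trans_le (hle x y), fun u v => ?_⟩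
  exact ⟨1, fun i => if i = 0 then u else v, by simp, by simp, fun i _ => hle _ _⟩

/-! ### Asymptotics of the grid size. -/

/-- The number of cells along each side of the period in dimension `n`. -/
noncomputable def gridSize (n : ℕ) : ℕ := n * ⌈Real.log n⌉₊

theorem two_le_gridSize {n : ℕ} (hn : 2 ≤ n) : 2 ≤ gridSize n := by
  have : 0 < ⌈Real.log n⌉₊ := Nat.ceil_pos.mpr (Real.log_pos (by exact_mod_cast hn))
  exact hn.trans (Nat.le_mul_of_pos_right n this)

theorem tendsto_log_natCast_atTop : Tendsto (fun n : ℕ => Real.log n) atTop atTop :=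
  Real.tendsto_log_atTop.comp tendsto_natCast_atTop_atTop

theorem tendsto_ceil_log_atTop :
    Tendsto (fun n : ℕ => (⌈Real.log n⌉₊ : ℝ)) atTop atTop :=
  tendsto_atTop_mono (fun n => Nat.le_ceil (Real.log n)) tendsto_log_natCast_atTop

/-- `log m = log n + log ⌈log n⌉`, and the second term is negligible. -/
theorem tendsto_log_gridSize_div_log :
    Tendsto (fun n : ℕ => Real.log (gridSize n) / Real.log n) atTop (𝓝 1) := by
  have h1 : Tendsto (fun n : ℕ => Real.log ⌈Real.log n⌉₊ / ⌈Real.log n⌉₊) atTop (𝓝 0) :=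
    Real.isLittleO_log_id_atTop.tendsto_div_nhds_zero.comp tendsto_ceil_log_atTop
  have h2 : Tendsto (fun n : ℕ => (⌈Real.log n⌉₊ : ℝ) / Real.log n) atTop (𝓝 1) :=
    tendsto_nat_ceil_div_atTop.comp tendsto_log_natCast_atTop
  have h3 := (h1.mul h2).const_add 1
  rw [zero_mul, add_zero] at h3
  refine h3.congr' ?_
  filter_upwards [eventually_ge_atTop 2] with n hn
  have hlog : 0 < Real.log n := Real.log_pos (by exact_mod_cast hn)
  have hc : (0 : ℝ) < ⌈Real.log n⌉₊ := by exact_mod_cast Nat.ceil_pos.mpr hlog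
  have hn0 : (n : ℝ) ≠ 0 := by positivity
  rw [gridSize, Nat.cast_mul, Real.log_mul hn0 hc.ne']
  field_simp

/-- The quotient `⌊s * m⌋₊ / n` is at least `s * ⌈log n⌉ - 1`; the factor `⌈log n⌉` in the grid size
is there to make this unbounded. -/
theorem tendsto_div_floor_gridSize {s : ℝ} (hs : 0 < s) :
    Tendsto (fun n : ℕ => (n : ℝ) / ⌊s * gridSize n⌋₊) atTop (𝓝 0) := by
  have h1 : Tendsto (fun n : ℕ => (⌊s * gridSize n⌋₊ : ℝ) / n) atTop atTop := by
    refine tendsto_atTop_mono' _ ?_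
      (tendsto_atTop_add_const_right _ (-1) (tendsto_ceil_log_atTop.const_mul_atTop hs))
    filter_upwards [eventually_ge_atTop 1] with n hn
    have hn' : (1 : ℝ) ≤ n := by exact_mod_cast hn
    have := Nat.lt_floor_add_one (s * gridSize n)
    rw [le_div_iff₀ (by positivity)]
    have hg : (gridSize n : ℝ) = n * ⌈Real.log n⌉₊ := by simp [gridSize]
    rw [hg] at this ⊢
    nlinarith
  refine h1.inv_tendsto_atTop.congr fun n => ?_
  simp

/-- Rounding the side of a cube down to the grid costs a factor of at most `exp (n / ⌊b⌋)`. -/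
theorem pow_le_floor_pow_mul_exp {b : ℝ} (n : ℕ) (hb : 1 ≤ b) :
    b ^ n ≤ (⌊b⌋₊ : ℝ) ^ n * Real.exp (n / ⌊b⌋₊) := by
  have hf : (0 : ℝ) < ⌊b⌋₊ := by exact_mod_cast Nat.floor_pos.mpr hb
  calc b ^ n ≤ ((⌊b⌋₊ : ℝ) * Real.exp (1 / ⌊b⌋₊)) ^ n := by
        gcongr
        calc b ≤ ⌊b⌋₊ * (1 / ⌊b⌋₊ + 1) := by
              rw [mul_add, mul_one_div_cancel hf.ne', mul_one, add_comm]
              exact (Nat.lt_floor_add_one b).le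
          _ ≤ _ := by gcongr; exact Real.add_one_le_exp _
    _ = _ := by
        rw [mul_pow, ← Real.exp_nat_mul]
        ring_nf

theorem theorem9 (M : Type*) [MetricSpace M] [Finite M] [Nontrivial M] :
    ∃ ε : ℕ → ℝ, Tendsto ε atTop (𝓝 0) ∧
      ∀ n : ℕ, 2 ≤ n →
        ∃ k : ℕ, forbiddenChromaticNumber (Fin n → ℝ) M = (k : ℕ∞) ∧
          (k : ℝ) < (1 + ε n) * ((n : ℝ) * Real.log (n : ℝ)) *
            (1 + stepLength M / Metric.diam (Set.univ : Set M)) ^ n := by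
  obtain ⟨⟨hl, hchain⟩, -⟩ := stepLength_isLeast M
  have hld := stepLength_le_diam M
  have hdiam := exists_dist_eq_diam M
  set l := stepLength M
  set d := Metric.diam (Set.univ : Set M)
  have hd : 0 < d := hl.trans_le hld
  set s : ℝ := d / (d + l) with hs
  have hs0 : 0 < s := by positivity
  have hs2 : 1 / 2 ≤ s := by
    rw [hs, div_le_div_iff₀ two_pos (by positivity)]
    linarith
  have hs1 : s ≤ 1 := by
    rw [hs, div_le_one (by positivity)]
    linarith
  have hsinv : 1 + l / d = s⁻¹ := by
    rw [hs]
    field_simp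
  -- The term `2 / (n * log n)` pays for rounding the number of colors up; that costs at most `1 ≤
  -- s⁻¹ ^ n`, and the `2` makes the final inequality strict.
  refine ⟨fun n => Real.log (gridSize n) / Real.log n * Real.exp (n / ⌊s * gridSize n⌋₊) +
    2 / (n * Real.log n) - 1, ?_, fun n hn => ?_⟩
  · have h1 := (Real.continuous_exp.tendsto 0).comp (tendsto_div_floor_gridSize hs0)
    have h2 : Tendsto (fun n : ℕ => 2 / (n * Real.log n)) atTop (𝓝 0) :=
      (tendsto_natCast_atTop_atTop.atTop_mul_atTop₀ tendsto_log_natCast_atTop).const_div_atTop 2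
    simpa using ((tendsto_log_gridSize_div_log.mul h1).add h2).sub_const 1
  · have hlog : 0 < Real.log n := Real.log_pos (by exact_mod_cast hn)
    have hm := two_le_gridSize hn
    set m := gridSize n
    have hm' : (2 : ℝ) ≤ m := by exact_mod_cast hm
    have : NeZero m := ⟨by omega⟩
    -- From `l ≤ d` comes `s ≥ 1 / 2`; with `m ≥ 2` the cube is nonempty for every `n ≥ 2`, not only
    -- for large `n`.
    have hsm : 1 ≤ s * m := by nlinarith
    set a := ⌊s * m⌋₊
    have ha : (a : ℝ) ≤ s * m := Nat.floor_le (by positivity)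
    have ha0 : (0 : ℝ) < a := by exact_mod_cast Nat.floor_pos.mpr hsm
    have ham : a ≤ m := by
      have : (a : ℝ) ≤ m := ha.trans (mul_le_of_le_one_left (by positivity) hs1)
      exact_mod_cast this
    set p : ℝ := ((a : ℝ) / m) ^ n with hp
    have hp0 : 0 < p := by positivity
    have hlogm : 0 ≤ Real.log m := Real.log_nonneg (by linarith)
    set N := ⌊n * Real.log m / p⌋₊ + 1 with hN
    have hN1 : n * Real.log m < p * N := by
      rw [← div_lt_iff₀' hp0]
      exact_mod_cast Nat.lt_floor_add_one (n * Real.log m / p)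
    have hN2 : (N : ℝ) ≤ n * Real.log m / p + 1 := by
      rw [hN, Nat.cast_add, Nat.cast_one]
      gcongr
      exact Nat.floor_le (by positivity)
    obtain ⟨k, hk, hkN⟩ := forbiddenChromaticNumber_le_of_coloring
      (exists_coloring_of_cover M hl hd hchain hdiam ha
        (exists_cubes_cover_torus n m a N ham hN1))
    refine ⟨k, hk, ?_⟩
    have hkN' : (k : ℝ) ≤ N := by exact_mod_cast hkN
    have hpinv : 1 / p ≤ s⁻¹ ^ n * Real.exp (n / a) := by
      have := pow_le_floor_pow_mul_exp n hsm
      rw [hp, div_pow, one_div_div, inv_pow, div_le_iff₀ (by positivity), inv_mul_eq_div,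
        div_mul_eq_mul_div, le_div_iff₀ (by positivity)]
      calc (m : ℝ) ^ n * s ^ n = (s * m) ^ n := by rw [mul_pow, mul_comm]
        _ ≤ _ := this
        _ = _ := mul_comm _ _
    have hone : 1 ≤ s⁻¹ ^ n := one_le_pow₀ ((one_le_inv₀ hs0).mpr hs1)
    have hmain : n * Real.log m / p ≤ n * Real.log m * (s⁻¹ ^ n * Real.exp (n / a)) := by
      rw [div_eq_mul_one_div]
      gcongr
    rw [hsinv]
    have hn0 : (0 : ℝ) < n := by positivity
    calc (k : ℝ) < n * Real.log m * (s⁻¹ ^ n * Real.exp (n / a)) + 2 * s⁻¹ ^ n := by linarith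
      _ = _ := by field_simp; ring
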